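/- Let $G$ be a group. For $x,y\in G$ write $x\sim y$ if $x$ and $y$ are conjugate, and $x^y=y^{-1}xy$. The group $G$ is \emph{semi-rational} if for every $x\in G$ the generators of $\langle x\rangle$ lie in a union of at most two conjugacy classes; \emph{inverse semi-rational} if for every $x\in G$ every generator $y$ of $\langle x\rangle$ satisfies $y\sim x$ or $y\sim x^{-1}$; \emph{$m$-semi-rational} ($m\in\mathbb{Z}$) if for every $x\in G$ every generator $y$ of $\langle x\rangle$ satisfies $y\sim x$ or $y\sim x^{m}$; and \emph{uniformly semi-rational} if it is $m$-semi-rational for some $m\in\mathbb{Z}$. \textbf{Theorem.} Let $G$ be a finite non-abelian metacyclic group given by $$G=\langle a,b\mid a^n=1,\ b^t=a^l,\ a^b=a^r\rangle,$$ where $n,t$ are positive integers and $r,l$ are natural numbers with $r^t\equiv 1 \pmod n$, $lr\equiv l \pmod n$ and $l\mid n$. Then $G$ is semi-rational if and only if $G$ is inverse semi-rational or isomorphic to one of the following 18 groups. 1. $\langle a,b\mid a^5=1,\ b^2=a^5,\ a^b=a^4\rangle$, $m=2$ 2. $\langle a,b\mid a^8=1,\ b^2=a^4,\ a^b=a^7\rangle$,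 $m=3$ 3. $\langle a,b\mid a^8=1,\ b^2=1,\ a^b=a^7\rangle$, $m=3$ 4. $\langle a,b\mid a^{10}=1,\ b^2=a^5,\ a^b=a^9\rangle$, $m=3$ 5. $\langle a,b\mid a^{10}=1,\ b^2=1,\ a^b=a^9\rangle$, $m=3$ 6. $\langle a,b\mid a^{12}=1,\ b^2=a^6,\ a^b=a^{11}\rangle$, $m=7$ 7. $\langle a,b\mid a^{12}=1,\ b^2=1,\ a^b=a^{11}\rangle$, $m=5$ 8. $\langle a,b\mid a^8=1,\ b^4=1,\ a^b=a^7\rangle$, $m=3$ 9. $\langle a,b\mid a^{10}=1,\ b^4=1,\ a^b=a^9\rangle$, $m=3$ 10. $\langle a,b\mid a^{12}=1,\ b^4=1,\ a^b=a^{11}\rangle$, $m=7$ 11. $\langle a,b\mid a^{13}=1,\ b^6=1,\ a^b=a^4\rangle$, $m=5$ 12. $\langle a,b\mid a^{21}=1,\ b^6=1,\ a^b=a^5\rangle$, $m=11$ 13. $\langle a,b\mid a^{26}=1,\ b^6=1,\ a^b=a^{17}\rangle$, $m=11$ 14. $\langle a,b\mid a^{28}=1,\ b^6=a^{14},\ a^b=a^3\rangle$,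 $m=5$ 15. $\langle a,b\mid a^{28}=1,\ b^6=1,\ a^b=a^3\rangle$, $m=5$ 16. $\langle a,b\mid a^{42}=1,\ b^6=1,\ a^b=a^5\rangle$, $m=11$ 17. $\langle a,b\mid a^8=1,\ b^4=a^4,\ a^b=a^3\rangle$ 18. $\langle a,b\mid a^{12}=1,\ b^4=a^6,\ a^b=a^{11}\rangle$ None of these 18 groups is inverse semi-rational. Each of the groups 1–16 is $m$-semi-rational for the indicated value of $m$. A semi-rational group $G$ as above is uniformly semi-rational if and only if it is isomorphic to neither group 17 nor group 18; these two groups are not isomorphic to each other, and both are semi-rational but not uniformly semi-rational. -/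

import Mathlib

/-- `x` is a semi-rational element: the generators of `⟨x⟩` lie in a union of at most two
conjugacy classes. -/
def IsSemiRationalElement {G : Type*} [Group G] (x : G) : Prop :=
  ∃ u v : G, ∀ y : G, Subgroup.zpowers y = Subgroup.zpowers x → IsConj u y ∨ IsConj v y

/-- `x` is an inverse semi-rational element: every generator of `⟨x⟩` is conjugate to `x` or to
`x⁻¹`. -/
def IsInverseSemiRationalElement {G : Type*} [Group G] (x : G) : Prop :=
  ∀ y : G, Subgroup.zpowers y = Subgroup.zpowers x → IsConj x y ∨ IsConj x⁻¹ y

/-- Every element of the group is semi-rational. -/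
def IsSemiRationalGroup (G : Type*) [Group G] : Prop :=
  ∀ x : G, IsSemiRationalElement x

/-- Every element of the group is inverse semi-rational. -/
def IsInverseSemiRationalGroup (G : Type*) [Group G] : Prop :=
  ∀ x : G, IsInverseSemiRationalElement x

/-- The group is `m`-semi-rational: for every element `x`, each generator of `⟨x⟩` is conjugate
to `x` or to `x ^ m`. -/
def IsMSemiRationalGroup (m : ℤ) (G : Type*) [Group G] : Prop :=
  ∀ x y : G, Subgroup.zpowers y = Subgroup.zpowers x → IsConj x y ∨ IsConj (x ^ m) y

/-- The group is `m`-semi-rational for some integer `m`. -/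
def IsUniformlySemiRationalGroup (G : Type*) [Group G] : Prop :=
  ∃ m : ℤ, IsMSemiRationalGroup m G

/-- The relators of `⟨a, b | a ^ n = 1, b ^ t = a ^ l, b⁻¹ a b = a ^ r⟩`, where `a` and `b` are the
free generators with index `0` and `1`. -/
def metacyclicRels (n t l r : ℕ) : Set (FreeGroup (Fin 2)) :=
  let a : FreeGroup (Fin 2) := FreeGroup.of 0
  let b : FreeGroup (Fin 2) := FreeGroup.of 1
  {a ^ n, b ^ t * (a ^ l)⁻¹, b⁻¹ * a * b * (a ^ r)⁻¹}

/-- The group `⟨a, b | a ^ n = 1, b ^ t = a ^ l, b⁻¹ a b = a ^ r⟩`. -/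
abbrev MetacyclicGroup (n t l r : ℕ) : Type :=
  PresentedGroup (metacyclicRels n t l r)

/-- The listed groups that come with a value of `m`: the entry `(n, t, l, r, m)` stands for
`MetacyclicGroup n t l r` and the value `m`. A relation `b ^ t = e` is written with `l = n`. -/
def uniformList : List (ℕ × ℕ × ℕ × ℕ × ℤ) :=
  [(5, 2, 5, 4, 2),
   (8, 2, 4, 7, 3),
   (8, 2, 8, 7, 3),
   (10, 2, 5, 9, 3),
   (10, 2, 10, 9, 3),
   (12, 2, 6, 11, 7),
   (12, 2, 12, 11, 5),
   (8, 4, 8, 7, 3),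
   (10, 4, 10, 9, 3),
   (12, 4, 12, 11, 7),
   (13, 6, 13, 4, 5),
   (21, 6, 21, 5, 11),
   (26, 6, 26, 17, 11),
   (28, 6, 14, 3, 5),
   (28, 6, 28, 3, 5),
   (42, 6, 42, 5, 11)]

/-- `G` is isomorphic to one of the sixteen listed groups that come with a value of `m`. -/
def IsInUniformList (G : Type*) [Group G] : Prop :=
  ∃ n t l r : ℕ, ∃ m : ℤ, (n, t, l, r, m) ∈ uniformList ∧ Nonempty (G ≃* MetacyclicGroup n t l r)

/-- `G` is isomorphic to one of the two listed groups that come without a value of `m`. -/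
def IsInExceptionalList (G : Type*) [Group G] : Prop :=
  Nonempty (G ≃* MetacyclicGroup 8 4 4 3) ∨ Nonempty (G ≃* MetacyclicGroup 12 4 6 11)

/-! The group has the normal form `b ^ j * a ^ i` with `j < t`, `i < n`, so it has order `t * n` and
all questions about powers and conjugacy become arithmetic. Conjugation by `b ^ s` multiplies `i` by
`r ^ s`, and conjugation by powers of `a` shifts `i` by multiples of `r ^ j - 1`. Hence `b ^ j * a ^
i` and `b ^ j * a ^ i'` are conjugate exactly when `i * r ^ s ≡ i'` modulo `gcd (n, r ^ j - 1)` for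
some `s` (`isConj_of_modEq`, `exists_modEq_of_isConj`).

Semi-rationality bounds the parameters. In the abelian quotient by `⟨a⟩`, cyclic of order `t`, a
conjugacy class has a single image, so two classes covering the generators of `⟨b⟩` force `φ t ≤ 2`
(`totient_t_le`). A class meets `⟨a⟩` in at most `t` elements, so `φ n ≤ 2 * t` (`totient_n_le`).
Since `t = 1` gives an abelian group, `t` is 2, 3, 4 or 6, and `φ n ≤ 12`; as `n ≤ 2 * φ n ^ 2`,
finitely many parameters remain.

For these the kernel evaluates Boolean tests proved sound by the conjugacy criterion. Each parameter
tuple either has a non-semi-rational element among `a`, `b`, `b ^ 2 * a`, `b * a`, or gives an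
inverse semi-rational group, or occurs in `isoList`, where explicit generators identify it with a
listed group. Different tuples may give the same group, for example after replacing `b` by `b ^ 5`.

For uniformity, an inverse semi-rational group has `m = -1`, and each of the sixteen groups has its
own `m`. In each exceptional group every residue of `m` is defeated by one of three elements. -/

/-- `a` and `b` generate `G`, satisfy the relations `a ^ n = 1`, `b ^ t = a ^ l`, `a * b = b * a ^ r`,
and every element of `G` is `b ^ j * a ^ i` for unique `j < t` and `i < n`. -/
structure IsMetacyclicPair {G : Type*} [Group G] (n t l r : ℕ) (a b : G) : Prop where
  n_pos : 0 < n
  t_pos : 0 < t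
  r_pos : 0 < r
  pow_modEq : r ^ t ≡ 1 [MOD n]
  mul_modEq : l * r ≡ l [MOD n]
  pow_n : a ^ n = 1
  pow_t : b ^ t = a ^ l
  mul_eq : a * b = b * a ^ r
  exists_eq : ∀ g : G, ∃ j < t, ∃ i < n, b ^ j * a ^ i = g
  eq_and_eq : ∀ j < t, ∀ i < n, ∀ j' < t, ∀ i' < n,
    b ^ j * a ^ i = b ^ j' * a ^ i' → j = j' ∧ i = i'

/-! ### Products and powers in normal form -/

section Relations

variable {G : Type*} [Group G] {a b : G} {r : ℕ}

theorem pow_mul_pow_of_mul_eq (h : a * b = b * a ^ r) (i s : ℕ) :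
    a ^ i * b ^ s = b ^ s * a ^ (i * r ^ s) := by
  have h1 : ∀ i : ℕ, a ^ i * b = b * a ^ (i * r) := by
    intro i
    have : SemiconjBy b (a ^ r) a := h.symm
    have := (this.pow_right i).eq
    rw [← pow_mul, mul_comm r] at this
    exact this.symm
  induction s generalizing i with
  | zero => simp
  | succ s ih => rw [pow_succ', ← mul_assoc, h1, mul_assoc, ih, ← mul_assoc, pow_succ', mul_assoc i]

theorem mul_pow_mul_pow_of_mul_eq (h : a * b = b * a ^ r) (j i s k : ℕ) :
    b ^ j * a ^ i * (b ^ s * a ^ k) = b ^ (j + s) * a ^ (i * r ^ s + k) := by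
  rw [mul_assoc, ← mul_assoc (a ^ i), pow_mul_pow_of_mul_eq h, pow_add, pow_add]
  simp only [mul_assoc]

theorem pow_mul_pow_pow_of_mul_eq (h : a * b = b * a ^ r) (j i k : ℕ) :
    (b ^ j * a ^ i) ^ k = b ^ (j * k) * a ^ (i * ∑ m ∈ Finset.range k, (r ^ j) ^ m) := by
  induction k with
  | zero => simp
  | succ k ih =>
    rw [pow_succ', ih, mul_pow_mul_pow_of_mul_eq h, Finset.sum_range_succ, ← pow_mul, mul_add,
      mul_add, add_comm (i * r ^ (j * k)), mul_one, add_comm (j * k)]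

end Relations

/-! ### Generators of cyclic subgroups -/

/-- Units of `ZMod N` surject onto units of `ZMod o`. Generators of `⟨x⟩` can therefore be written
with exponents coprime to any nonzero `N` satisfying `x ^ N = 1`; the exact order is never needed.
-/
theorem Nat.exists_coprime_modEq {k o N : ℕ} (hk : k.Coprime o) (ho : o ∣ N) (hN : N ≠ 0) :
    ∃ k' < N, k'.Coprime N ∧ k' ≡ k [MOD o] := by
  have : NeZero N := ⟨hN⟩
  obtain ⟨u, hu⟩ := ZMod.unitsMap_surjective ho (ZMod.unitOfCoprime k hk)
  refine ⟨(u : ZMod N).val, ZMod.val_lt _, ZMod.val_coe_unit_coprime u, ?_⟩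
  have := congrArg Units.val hu
  rw [ZMod.unitsMap_val, ZMod.coe_unitOfCoprime, ZMod.cast_eq_val] at this
  exact (ZMod.natCast_eq_natCast_iff _ _ _).1 this

section Generators

variable {G : Type*} [Group G] {x y : G}

theorem zpowers_pow_eq_zpowers {N k : ℕ} (hx : x ^ N = 1) (hk : k.Coprime N) :
    Subgroup.zpowers (x ^ k) = Subgroup.zpowers x := by
  apply le_antisymm
  · rw [Subgroup.zpowers_le]
    exact Subgroup.npow_mem_zpowers x k
  · rw [Subgroup.zpowers_le, mem_zpowers_pow_iff]
    exact hk.coprime_dvd_right (orderOf_dvd_of_pow_eq_one hx)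

theorem exists_coprime_pow_eq {N : ℕ} (hN : N ≠ 0) (hx : x ^ N = 1)
    (h : Subgroup.zpowers y = Subgroup.zpowers x) : ∃ k < N, k.Coprime N ∧ x ^ k = y := by
  have hfin : IsOfFinOrder x := isOfFinOrder_iff_pow_eq_one.2 ⟨N, Nat.pos_of_ne_zero hN, hx⟩
  have hy : y ∈ Subgroup.zpowers x := h ▸ Subgroup.mem_zpowers y
  obtain ⟨k, rfl⟩ := hfin.mem_powers_iff_mem_zpowers.2 hy
  have hk : k.Coprime (orderOf x) := mem_zpowers_pow_iff.1 (h ▸ Subgroup.mem_zpowers x)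
  obtain ⟨k', hlt, hc, hm⟩ := Nat.exists_coprime_modEq hk (orderOf_dvd_of_pow_eq_one hx) hN
  exact ⟨k', hlt, hc, pow_eq_pow_iff_modEq.2 hm⟩

end Generators

/-! ### Semi-rational elements under conjugation and powers -/

/-- Every generator of `⟨x⟩` is conjugate to `x` or to `x ^ m`. -/
def IsMSemiRationalElement {G : Type*} [Group G] (m : ℤ) (x : G) : Prop :=
  ∀ y : G, Subgroup.zpowers y = Subgroup.zpowers x → IsConj x y ∨ IsConj (x ^ m) y

theorem IsConj.zpow_zpow {G : Type*} [Group G] {x y : G} (h : IsConj x y) (m : ℤ) :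
    IsConj (x ^ m) (y ^ m) := by
  obtain ⟨c, rfl⟩ := isConj_iff.1 h
  exact isConj_iff.2 ⟨c, by rw [conj_zpow]⟩

namespace IsMSemiRationalElement

variable {G : Type*} [Group G] {m : ℤ} {x y : G}

theorem of_isConj (hx : IsMSemiRationalElement m x) (h : IsConj x y) :
    IsMSemiRationalElement m y := by
  intro z hz
  obtain ⟨c, rfl⟩ := isConj_iff.1 h
  have hz' : Subgroup.zpowers (c⁻¹ * z * c) = Subgroup.zpowers x := by
    have e1 : c⁻¹ * z * c = (MulAut.conj c⁻¹).toMonoidHom z := by simp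
    have e2 : x = (MulAut.conj c⁻¹).toMonoidHom (c * x * c⁻¹) := by simp [mul_assoc]
    rw [e1]
    conv_rhs => rw [e2]
    rw [← MonoidHom.map_zpowers, ← MonoidHom.map_zpowers, hz]
  have hzc : IsConj (c⁻¹ * z * c) z := isConj_iff.2 ⟨c, by group⟩
  rcases hx _ hz' with h1 | h1
  · exact Or.inl (h.symm.trans (h1.trans hzc))
  · exact Or.inr ((h.symm.zpow_zpow m).trans (h1.trans hzc))

/-- A generator of `⟨x ^ i⟩` has the form `(x ^ i) ^ k` with `k` coprime to the order of `x`. Then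
`x ^ k` generates `⟨x⟩`, and the conjugacy known for it can be raised to the power `i`. So
generators of the maximal cyclic subgroups suffice. -/
theorem pow (hx : IsMSemiRationalElement m x) (hfin : IsOfFinOrder x) (i : ℕ) :
    IsMSemiRationalElement m (x ^ i) := by
  intro y hy
  have hN := hfin.orderOf_pos.ne'
  obtain ⟨k, -, hk, rfl⟩ := exists_coprime_pow_eq hN
    (by rw [← pow_mul, mul_comm, pow_mul, pow_orderOf_eq_one, one_pow]) hy
  rcases hx (x ^ k) (zpowers_pow_eq_zpowers (pow_orderOf_eq_one x) hk) with h1 | h1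
  · left
    have := h1.pow i
    rwa [← pow_mul, mul_comm, pow_mul] at this
  · right
    have := h1.pow i
    rw [← pow_mul, mul_comm k, pow_mul] at this
    convert this using 1
    rw [← zpow_natCast, ← zpow_natCast, ← zpow_mul, ← zpow_mul, mul_comm]

theorem of_forall_lt {N : ℕ} (hN : N ≠ 0) (hx : x ^ N = 1)
    (h : ∀ k < N, k.Coprime N → IsConj x (x ^ k) ∨ IsConj (x ^ m) (x ^ k)) :
    IsMSemiRationalElement m x := by
  intro y hy
  obtain ⟨k, hk, hc, rfl⟩ := exists_coprime_pow_eq hN hx hy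
  exact h k hk hc

theorem isSemiRationalElement (hx : IsMSemiRationalElement m x) : IsSemiRationalElement x :=
  ⟨x, x ^ m, hx⟩

end IsMSemiRationalElement

/-! ### The conjugacy criterion -/

namespace IsMetacyclicPair

variable {G : Type*} [Group G] {n t l r : ℕ} {a b : G}

theorem pow_eq_pow (h : IsMetacyclicPair n t l r a b) {i i' : ℕ} (hi : i ≡ i' [MOD n]) :
    a ^ i = a ^ i' := by
  rw [← Nat.mod_add_div i n, ← Nat.mod_add_div i' n, pow_add, pow_add, pow_mul, pow_mul, h.pow_n,
    one_pow, one_pow, show i % n = i' % n from hi]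

theorem pow_mul_pow_eq (h : IsMetacyclicPair n t l r a b) (j i : ℕ) :
    b ^ j * a ^ i = b ^ (j % t) * a ^ ((i + l * (j / t)) % n) := by
  rw [h.pow_eq_pow (Nat.mod_modEq (i + l * (j / t)) n), add_comm i, pow_add, pow_mul a l, ← h.pow_t,
    ← mul_assoc, ← pow_mul, ← pow_add, Nat.mod_add_div]

theorem pow_mul_pow_inj (h : IsMetacyclicPair n t l r a b) {j i j' i' : ℕ}
    (e : b ^ j * a ^ i = b ^ j' * a ^ i') :
    j ≡ j' [MOD t] ∧ i + l * (j / t) ≡ i' + l * (j' / t) [MOD n] := by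
  rw [h.pow_mul_pow_eq j, h.pow_mul_pow_eq j'] at e
  exact h.eq_and_eq _ (Nat.mod_lt _ h.t_pos) _ (Nat.mod_lt _ h.n_pos) _ (Nat.mod_lt _ h.t_pos) _
    (Nat.mod_lt _ h.n_pos) e

theorem isConj_of_modEq (h : IsMetacyclicPair n t l r a b) {j i i' s : ℕ}
    (e : i * r ^ s ≡ i' [MOD n.gcd (r ^ j - 1)]) : IsConj (b ^ j * a ^ i) (b ^ j * a ^ i') := by
  have h1 : IsConj (b ^ j * a ^ i) (b ^ j * a ^ (i * r ^ s)) := by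
    refine isConj_iff.2 ⟨(b ^ s)⁻¹, ?_⟩
    rw [inv_inv, mul_assoc, inv_mul_eq_iff_eq_mul]
    have := mul_pow_mul_pow_of_mul_eq h.mul_eq j i s 0
    rw [pow_zero, mul_one, add_zero] at this
    rw [this, ← mul_assoc, ← pow_add, add_comm]
  refine h1.trans ?_
  have hr : 1 ≤ r ^ j := Nat.pow_pos h.r_pos
  have e2 : ((n.gcd (r ^ j - 1) : ℕ) : ℤ) ∣ (i' : ℤ) - (i * r ^ s : ℕ) := Nat.modEq_iff_dvd.1 e
  obtain ⟨c, hc⟩ := e2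
  rw [Nat.gcd_eq_gcd_ab, Nat.cast_sub hr] at hc
  set v : ℤ := Nat.gcdB n (r ^ j - 1) with hv
  -- Conjugating by `a ^ k` requires `i * r ^ s + k ≡ k * r ^ j + i'` modulo `n`, that is, `i' - i *
  -- r ^ s ≡ -k * (r ^ j - 1)`. By Bézout the left side is `c * v * (r ^ j - 1)` modulo `n`, so `k ≡
  -- -(v * c)` works.
  set k : ℕ := ((-(v * c)) % n).toNat with hk
  have hn : (n : ℤ) ≠ 0 := by exact_mod_cast h.n_pos.ne'
  have hk' : (k : ℤ) ≡ -(v * c) [ZMOD n] := by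
    rw [hk, Int.toNat_of_nonneg (Int.emod_nonneg _ hn)]
    exact Int.mod_modEq _ _
  have key : i * r ^ s + k ≡ k * r ^ j + i' [MOD n] := by
    rw [← Int.natCast_modEq_iff]
    push_cast at hc ⊢
    have : (i' : ℤ) = i * r ^ s + (n * Nat.gcdA n (r ^ j - 1) + (r ^ j - 1) * v) * c := by
      linear_combination hc
    rw [this]
    have e3 : (k : ℤ) * r ^ j + (i * r ^ s + (n * Nat.gcdA n (r ^ j - 1) + (r ^ j - 1) * v) * c)
       = i * r ^ s + (k * (r ^ j - 1) + (v * c) * (r ^ j - 1)) + k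
        + n * (Nat.gcdA n (r ^ j - 1) * c) := by ring
    rw [e3]
    have e4 : (k : ℤ) * (r ^ j - 1) + (v * c) * (r ^ j - 1) ≡ 0 [ZMOD n] := by
      have := (hk'.mul_right (r ^ j - 1 : ℤ)).add_right ((v * c) * (r ^ j - 1))
      rwa [neg_mul, neg_add_cancel] at this
    have e5 : (n : ℤ) * (Nat.gcdA n (r ^ j - 1) * c) ≡ 0 [ZMOD n] :=
      (Int.modEq_zero_iff_dvd).2 (Dvd.intro _ rfl)
    have := (((Int.ModEq.refl (i * r ^ s : ℤ)).add e4).add_right (k : ℤ)).add e5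
    simpa using this.symm
  refine isConj_iff.2 ⟨(a ^ k)⁻¹, ?_⟩
  rw [inv_inv, mul_assoc, inv_mul_eq_iff_eq_mul, mul_assoc, ← pow_add, h.pow_eq_pow key, pow_add,
    ← mul_assoc, ← pow_mul_pow_of_mul_eq h.mul_eq, mul_assoc]

/-- Write the inverse of the conjugating element as `b ^ s * a ^ k` and compare normal forms. The
terms in `k` cancel because `r ^ j ≡ 1` modulo the gcd. -/
theorem exists_modEq_of_isConj (h : IsMetacyclicPair n t l r a b) {j i j' i' : ℕ} (hj : j < t)
    (hj' : j' < t) (hc : IsConj (b ^ j * a ^ i) (b ^ j' * a ^ i')) :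
    j = j' ∧ ∃ s < t, i * r ^ s ≡ i' [MOD n.gcd (r ^ j - 1)] := by
  obtain ⟨g, hg⟩ := isConj_iff.1 hc
  obtain ⟨s, hs, k, hk, e⟩ := h.exists_eq g⁻¹
  have hg' : b ^ j * a ^ i * g⁻¹ = g⁻¹ * (b ^ j' * a ^ i') := by rw [← hg]; group
  rw [← e, mul_pow_mul_pow_of_mul_eq h.mul_eq, mul_pow_mul_pow_of_mul_eq h.mul_eq] at hg'
  obtain ⟨e1, e2⟩ := h.pow_mul_pow_inj hg'
  have hjj : j = j' := by
    rw [add_comm s] at e1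
    have := Nat.ModEq.add_right_cancel' s e1
    rwa [Nat.ModEq, Nat.mod_eq_of_lt hj, Nat.mod_eq_of_lt hj'] at this
  subst hjj
  refine ⟨rfl, s, hs, ?_⟩
  rw [add_comm s j] at e2
  have e3 := Nat.ModEq.add_right_cancel' _ e2
  have e4 := e3.of_dvd (Nat.gcd_dvd_left n (r ^ j - 1))
  have hr : 1 ≤ r ^ j := Nat.pow_pos h.r_pos
  have e5 : r ^ j ≡ 1 [MOD n.gcd (r ^ j - 1)] :=
    ((Nat.modEq_iff_dvd' hr).2 (Nat.gcd_dvd_right _ _)).symm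
  have e6 := e4.trans ((e5.mul_left k).add_right i')
  rw [mul_one, add_comm k] at e6
  exact Nat.ModEq.add_right_cancel' k e6

theorem mul_comm_of_modEq (h : IsMetacyclicPair n t l r a b) (hr : r ≡ 1 [MOD n]) (x y : G) :
    x * y = y * x := by
  obtain ⟨j, -, i, -, rfl⟩ := h.exists_eq x
  obtain ⟨j', -, i', -, rfl⟩ := h.exists_eq y
  have hab : Commute a b := by
    have := h.mul_eq
    rwa [h.pow_eq_pow hr, pow_one] at this
  have h1 := (Commute.refl b).pow_pow j j'
  have h2 := (Commute.refl a).pow_pow i i'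
  exact ((h1.mul_right (hab.symm.pow_pow j i')).mul_left ((hab.pow_pow i j').mul_right h2)).eq

theorem bijective (h : IsMetacyclicPair n t l r a b) :
    Function.Bijective fun p : Fin t × Fin n => b ^ (p.1 : ℕ) * a ^ (p.2 : ℕ) := by
  constructor
  · rintro ⟨j, i⟩ ⟨j', i'⟩ e
    obtain ⟨e1, e2⟩ := h.eq_and_eq j j.2 i i.2 j' j'.2 i' i'.2 e
    exact Prod.ext (Fin.ext e1) (Fin.ext e2)
  · intro g
    obtain ⟨j, hj, i, hi, e⟩ := h.exists_eq g
    exact ⟨(⟨j, hj⟩, ⟨i, hi⟩), e⟩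

theorem natCard_eq (h : IsMetacyclicPair n t l r a b) : Nat.card G = t * n := by
  rw [← Nat.card_congr (Equiv.ofBijective _ h.bijective)]
  simp

theorem finite (h : IsMetacyclicPair n t l r a b) : Finite G :=
  Finite.of_surjective _ h.bijective.2

theorem map {H : Type*} [Group H] (h : IsMetacyclicPair n t l r a b) (f : G ≃* H) :
    IsMetacyclicPair n t l r (f a) (f b) where
  n_pos := h.n_pos
  t_pos := h.t_pos
  r_pos := h.r_pos
  pow_modEq := h.pow_modEq
  mul_modEq := h.mul_modEq
  pow_n := by rw [← map_pow, h.pow_n, map_one]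
  pow_t := by rw [← map_pow, ← map_pow, h.pow_t]
  mul_eq := by rw [← map_pow, ← map_mul, ← map_mul, h.mul_eq]
  exists_eq g := by
    obtain ⟨j, hj, i, hi, e⟩ := h.exists_eq (f.symm g)
    exact ⟨j, hj, i, hi, by rw [← map_pow, ← map_pow, ← map_mul, e, f.apply_symm_apply]⟩
  eq_and_eq j hj i hi j' hj' i' hi' e := by
    rw [← map_pow, ← map_pow, ← map_mul, ← map_pow, ← map_pow, ← map_mul] at e
    exact h.eq_and_eq j hj i hi j' hj' i' hi' (f.injective e)

/-- Only `r` modulo `n` matters, which leaves finitely many values to test. Positivity must be kept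
because the criterion uses the truncated difference `r ^ j - 1`. -/
theorem mod (h : IsMetacyclicPair n t l r a b) (hr : 0 < r % n) :
    IsMetacyclicPair n t l (r % n) a b where
  n_pos := h.n_pos
  t_pos := h.t_pos
  r_pos := hr
  pow_modEq := ((Nat.mod_modEq r n).pow t).trans h.pow_modEq
  mul_modEq := ((Nat.mod_modEq r n).mul_left l).trans h.mul_modEq
  pow_n := h.pow_n
  pow_t := h.pow_t
  mul_eq := by rw [h.pow_eq_pow (Nat.mod_modEq r n), h.mul_eq]
  exists_eq := h.exists_eq
  eq_and_eq := h.eq_and_eq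

end IsMetacyclicPair

/-! ### Boolean tests on parameters -/

/-- The sum `1 + R + ⋯ + R ^ (k - 1)`, for positive `R`. -/
def geomSum (R k : ℕ) : ℕ :=
  bif R.beq 1 then k else (R ^ k - 1) / (R - 1)

/-- The closed form keeps evaluation cheap. The value `R = 1`, where the quotient would be `0 / 0`,
is treated apart. -/
theorem geomSum_eq_sum {R : ℕ} (hR : 0 < R) (k : ℕ) :
    geomSum R k = ∑ m ∈ Finset.range k, R ^ m := by
  unfold geomSum
  rcases eq_or_ne R 1 with rfl | h
  · simp
  · have : R.beq 1 = false := by rwa [← Bool.not_eq_true, Nat.beq_eq]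
    rw [this, cond_false, Nat.geomSum_eq (by omega)]

/-- The exponent of `a` in the normal form of `(b ^ j * a ^ i) ^ k`. -/
def powExp (n t l r j i k : ℕ) : ℕ :=
  (i * geomSum (r ^ j) k + l * (j * k / t)) % n

/-- Tests equality of `b ^ j * a ^ i` and `b ^ j' * a ^ i'`. -/
def eqCheck (n t l j i j' i' : ℕ) : Bool :=
  (j % t).beq (j' % t) && ((i + l * (j / t)) % n).beq ((i' + l * (j' / t)) % n)

/-- Tests conjugacy of `b ^ j * a ^ i` and `b ^ j' * a ^ i'`, for `j, j' < t`. -/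
def conjCheck (n t r j i j' i' : ℕ) : Bool :=
  j.beq j' && (List.range t).any fun s =>
    (i * r ^ s % n.gcd (r ^ j - 1)).beq (i' % n.gcd (r ^ j - 1))

/-- Tests conjugacy of `(b ^ j * a ^ i) ^ k` and `(b ^ j * a ^ i) ^ k'`. -/
def powConjCheck (n t l r j i k k' : ℕ) : Bool :=
  conjCheck n t r (j * k % t) (powExp n t l r j i k) (j * k' % t) (powExp n t l r j i k')

/-- Tests `(b ^ j * a ^ i) ^ N = 1`, for positive `N`. -/
def powCheck (n t l r j i N : ℕ) : Bool :=
  !N.beq 0 && ((j * N % t).beq 0 && (powExp n t l r j i N).beq 0)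

/-- The order of `b ^ j * a ^ i`. -/
def elemOrder (n t l r j i : ℕ) : ℕ :=
  t / t.gcd j * (n / n.gcd (powExp n t l r j i (t / t.gcd j)))

/-- Tests that every generator of `⟨x⟩` is conjugate to `x` or `x ^ m`, where `x = b ^ j * a ^ i`
and `x ^ N = 1`. -/
def elemCheck (n t l r j i N m : ℕ) : Bool :=
  powCheck n t l r j i N && (List.range N).all fun k =>
    !(N.gcd k).beq 1 || (powConjCheck n t l r j i 1 k || powConjCheck n t l r j i m k)

/-- Tests that some generator of `⟨x⟩` is conjugate to neither `x` nor `x ^ m`, where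
`x = b ^ j * a ^ i` and `x ^ N = 1`. -/
def elemNegCheck (n t l r j i N m : ℕ) : Bool :=
  powCheck n t l r j i N && (List.range N).any fun k =>
    (N.gcd k).beq 1 && (!powConjCheck n t l r j i 1 k && !powConjCheck n t l r j i m k)

/-- Runs `p j i N` for elements `b ^ j * a ^ i` of order `N` that, up to conjugacy, include
a generator of each maximal cyclic subgroup. -/
def groupCheck (n t l r : ℕ) (p : ℕ → ℕ → ℕ → Bool) : Bool :=
  p 0 1 n && (List.range t).all fun j => j.beq 0 ||
    (List.range (n.gcd (r ^ j - 1))).all fun i => p j i (elemOrder n t l r j i)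

/-- Tests inverse semi-rationality of the group. -/
def invCheck (n t l r : ℕ) : Bool :=
  groupCheck n t l r fun j i N => elemCheck n t l r j i N (N - 1)

/-- Tests that `x, x ^ k, x ^ k'` are pairwise nonconjugate generators of `⟨x⟩` for some `k, k'`,
where `x = b ^ j * a ^ i`. -/
def notSemiCheck (n t l r j i N : ℕ) : Bool :=
  powCheck n t l r j i N && (List.range N).any fun k =>
    (N.gcd k).beq 1 && (!powConjCheck n t l r j i 1 k && (List.range N).any fun k' =>
      (N.gcd k').beq 1 && (!powConjCheck n t l r j i 1 k' && !powConjCheck n t l r j i k k'))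

/-! ### Soundness of the tests -/

namespace IsMetacyclicPair

variable {G : Type*} [Group G] {n t l r : ℕ} {a b : G}

theorem pow_eq_geomSum (h : IsMetacyclicPair n t l r a b) (j i k : ℕ) :
    (b ^ j * a ^ i) ^ k = b ^ (j * k) * a ^ (i * geomSum (r ^ j) k) := by
  rw [pow_mul_pow_pow_of_mul_eq h.mul_eq, geomSum_eq_sum (Nat.pow_pos h.r_pos)]

theorem pow_eq_powExp (h : IsMetacyclicPair n t l r a b) (j i k : ℕ) :
    (b ^ j * a ^ i) ^ k = b ^ (j * k % t) * a ^ powExp n t l r j i k := by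
  rw [h.pow_eq_geomSum, h.pow_mul_pow_eq, powExp]

theorem eq_of_eqCheck (h : IsMetacyclicPair n t l r a b) {j i j' i' : ℕ}
    (e : eqCheck n t l j i j' i' = true) : b ^ j * a ^ i = b ^ j' * a ^ i' := by
  simp only [eqCheck, Bool.and_eq_true, Nat.beq_eq] at e
  rw [h.pow_mul_pow_eq, h.pow_mul_pow_eq j', e.1, e.2]

theorem conjCheck_iff (h : IsMetacyclicPair n t l r a b) {j i j' i' : ℕ} (hj : j < t)
    (hj' : j' < t) :
    conjCheck n t r j i j' i' = true ↔ IsConj (b ^ j * a ^ i) (b ^ j' * a ^ i') := by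
  simp only [conjCheck, Bool.and_eq_true, Nat.beq_eq, List.any_eq_true, List.mem_range]
  constructor
  · rintro ⟨rfl, s, -, e⟩
    exact h.isConj_of_modEq e
  · exact h.exists_modEq_of_isConj hj hj'

theorem powConjCheck_iff (h : IsMetacyclicPair n t l r a b) {j i k k' : ℕ} :
    powConjCheck n t l r j i k k' = true ↔ IsConj ((b ^ j * a ^ i) ^ k) ((b ^ j * a ^ i) ^ k') := by
  rw [powConjCheck, h.conjCheck_iff (Nat.mod_lt _ h.t_pos) (Nat.mod_lt _ h.t_pos),
    h.pow_eq_powExp, h.pow_eq_powExp]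

theorem of_powCheck (h : IsMetacyclicPair n t l r a b) {j i N : ℕ}
    (e : powCheck n t l r j i N = true) : N ≠ 0 ∧ (b ^ j * a ^ i) ^ N = 1 := by
  simp only [powCheck, Bool.and_eq_true, Bool.not_eq_true', ← Bool.not_eq_true, Nat.beq_eq] at e
  rw [h.pow_eq_powExp, e.2.1, e.2.2]
  simpa using e.1

theorem of_elemCheck (h : IsMetacyclicPair n t l r a b) {j i N m : ℕ}
    (e : elemCheck n t l r j i N m = true) : IsMSemiRationalElement m (b ^ j * a ^ i) := by
  simp only [elemCheck, Bool.and_eq_true, List.all_eq_true, List.mem_range, Bool.or_eq_true,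
    Bool.not_eq_true', h.powConjCheck_iff, pow_one] at e
  obtain ⟨hN, hx⟩ := h.of_powCheck e.1
  refine .of_forall_lt hN hx fun k hk hc => ?_
  rw [zpow_natCast]
  rcases e.2 k hk with h1 | h1
  · exact absurd (hc.symm : N.gcd k = 1) (by rwa [← Bool.not_eq_true, Nat.beq_eq] at h1)
  · exact h1

theorem of_elemCheck_pred (h : IsMetacyclicPair n t l r a b) {j i N : ℕ}
    (e : elemCheck n t l r j i N (N - 1) = true) :
    IsMSemiRationalElement (-1) (b ^ j * a ^ i) := by
  have h1 := h.of_elemCheck e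
  obtain ⟨hN, hx⟩ := h.of_powCheck (by rw [elemCheck, Bool.and_eq_true] at e; exact e.1)
  have h2 : (b ^ j * a ^ i) ^ ((N - 1 : ℕ) : ℤ) = (b ^ j * a ^ i) ^ (-1 : ℤ) := by
    rw [zpow_natCast, zpow_neg_one, eq_inv_iff_mul_eq_one, ← pow_succ, Nat.sub_add_cancel
      (Nat.one_le_iff_ne_zero.2 hN), hx]
  intro y hy
  rw [← h2]
  exact h1 y hy

theorem of_elemNegCheck (h : IsMetacyclicPair n t l r a b) {j i N m : ℕ}
    (e : elemNegCheck n t l r j i N m = true) : ¬ IsMSemiRationalElement m (b ^ j * a ^ i) := by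
  simp only [elemNegCheck, Bool.and_eq_true, List.any_eq_true, List.mem_range, Nat.beq_eq,
    Bool.not_eq_true', ← Bool.not_eq_true, h.powConjCheck_iff, pow_one] at e
  obtain ⟨e1, k, -, hc, e2, e3⟩ := e
  obtain ⟨hN, hx⟩ := h.of_powCheck e1
  intro hm
  rcases hm _ (zpowers_pow_eq_zpowers hx (Nat.Coprime.symm hc)) with h1 | h1
  · exact e2 h1
  · exact e3 (by rwa [zpow_natCast] at h1)

/-- Since `x ^ N = 1`, the exponent `m'` acts only through its residue modulo `N`. This reduces
integer exponents, including `-1`, to natural numbers. -/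
theorem of_elemNegCheck_modEq (h : IsMetacyclicPair n t l r a b) {j i N m : ℕ} {m' : ℤ}
    (hm : m' ≡ m [ZMOD N]) (e : elemNegCheck n t l r j i N m = true) :
    ¬ IsMSemiRationalElement m' (b ^ j * a ^ i) := by
  have h1 := h.of_elemNegCheck e
  obtain ⟨hN, hx⟩ := h.of_powCheck (by rw [elemNegCheck, Bool.and_eq_true] at e; exact e.1)
  have h2 : (b ^ j * a ^ i) ^ m' = (b ^ j * a ^ i) ^ (m : ℤ) := by
    obtain ⟨c, hc⟩ := hm.dvd
    rw [eq_add_of_sub_eq hc, zpow_add, zpow_mul, zpow_natCast, hx, one_zpow, one_mul]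
  intro h3
  refine h1 fun y hy => ?_
  rw [← h2]
  exact h3 y hy

theorem of_notSemiCheck (h : IsMetacyclicPair n t l r a b) {j i N : ℕ}
    (e : notSemiCheck n t l r j i N = true) : ¬ IsSemiRationalElement (b ^ j * a ^ i) := by
  simp only [notSemiCheck, Bool.and_eq_true, List.any_eq_true, List.mem_range, Nat.beq_eq,
    Bool.not_eq_true', ← Bool.not_eq_true, h.powConjCheck_iff, pow_one] at e
  obtain ⟨e1, k, -, hc, e2, k', -, hc', e3, e4⟩ := e
  obtain ⟨hN, hx⟩ := h.of_powCheck e1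
  rintro ⟨u, v, huv⟩
  have h0 := huv _ rfl
  have h1 := huv _ (zpowers_pow_eq_zpowers hx (Nat.Coprime.symm hc))
  have h2 := huv _ (zpowers_pow_eq_zpowers hx (Nat.Coprime.symm hc'))
  -- Two of the three pairwise nonconjugate generators would share a class, by pigeonhole.
  rcases h0 with h0 | h0 <;> rcases h1 with h1 | h1 <;> rcases h2 with h2 | h2 <;>
    first
    | exact e2 (h0.symm.trans h1)
    | exact e3 (h0.symm.trans h2)
    | exact e4 (h1.symm.trans h2)

/-- For `j = 0` the element is a power of `a`. For other `j` it is conjugate to one whose exponent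
of `a` is reduced modulo `gcd (n, r ^ j - 1)`. The value of `elemOrder` need not be trusted here:
the tests that are used recheck `x ^ N = 1` through `powCheck`. -/
theorem forall_of_groupCheck (h : IsMetacyclicPair n t l r a b) {p : ℕ → ℕ → ℕ → Bool}
    {P : G → Prop} (hconj : ∀ x y, IsConj x y → P x → P y) (hpow : ∀ x (i : ℕ), P x → P (x ^ i))
    (hp : ∀ j < t, ∀ i N, p j i N = true → P (b ^ j * a ^ i))
    (e : groupCheck n t l r p = true) (x : G) : P x := by
  simp only [groupCheck, Bool.and_eq_true, List.all_eq_true, List.mem_range, Bool.or_eq_true,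
    Nat.beq_eq] at e
  obtain ⟨j, hj, i, -, rfl⟩ := h.exists_eq x
  rcases eq_or_ne j 0 with rfl | h0
  · have := hpow _ i (hp 0 hj 1 n e.1)
    simpa using this
  · have hd : 0 < n.gcd (r ^ j - 1) := Nat.gcd_pos_of_pos_left _ h.n_pos
    have h1 := hp j hj _ _ (((e.2 j hj).resolve_left h0) (i % _) (Nat.mod_lt i hd))
    refine hconj _ _ (h.isConj_of_modEq (s := 0) ?_) h1
    rw [pow_zero, mul_one]
    exact Nat.mod_modEq _ _

theorem forall_isMSemiRationalElement (h : IsMetacyclicPair n t l r a b) {p : ℕ → ℕ → ℕ → Bool}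
    {m : ℤ} (hp : ∀ j i N, p j i N = true → IsMSemiRationalElement m (b ^ j * a ^ i))
    (e : groupCheck n t l r p = true) (x : G) : IsMSemiRationalElement m x := by
  have := h.finite
  exact h.forall_of_groupCheck (fun _ _ hc hx => hx.of_isConj hc)
    (fun x i hx => hx.pow (isOfFinOrder_of_finite x) i) (fun j _ i N => hp j i N) e x

theorem isMSemiRationalGroup (h : IsMetacyclicPair n t l r a b) {m : ℕ}
    (e : groupCheck n t l r (fun j i N => elemCheck n t l r j i N m) = true) :
    IsMSemiRationalGroup m G :=
  h.forall_isMSemiRationalElement (fun _ _ _ => h.of_elemCheck) e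

theorem isMSemiRationalGroup_neg_one (h : IsMetacyclicPair n t l r a b)
    (e : invCheck n t l r = true) : IsMSemiRationalGroup (-1) G :=
  h.forall_isMSemiRationalElement (fun _ _ _ => h.of_elemCheck_pred) e

theorem isSemiRationalGroup (h : IsMetacyclicPair n t l r a b)
    (e : groupCheck n t l r
      (fun j i N => (List.range N).any fun m => elemCheck n t l r j i N m) = true) :
    IsSemiRationalGroup G := by
  have := h.finite
  have key : ∀ x : G, ∃ m : ℤ, IsMSemiRationalElement m x :=
    h.forall_of_groupCheck (fun _ _ hc ⟨m, hx⟩ => ⟨m, hx.of_isConj hc⟩)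
      (fun x i ⟨m, hx⟩ => ⟨m, hx.pow (isOfFinOrder_of_finite x) i⟩)
      (fun j _ i N hp => by
        obtain ⟨m, -, hm⟩ := List.any_eq_true.1 hp
        exact ⟨m, h.of_elemCheck hm⟩) e
  exact fun x => (key x).elim fun m hm => hm.isSemiRationalElement

/-- Tests that for every `m < N` one of the elements `b ^ j * a ^ i`, with `(j, i)` in the list
`w`, satisfies `elemNegCheck`. -/
def _root_.notUniformCheck (n t l r N : ℕ) (w : List (ℕ × ℕ)) : Bool :=
  (List.range N).all fun m => w.any fun x => elemNegCheck n t l r x.1 x.2 N m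

theorem not_isUniformlySemiRationalGroup (h : IsMetacyclicPair n t l r a b) {N : ℕ}
    (hN : N ≠ 0) {w : List (ℕ × ℕ)} (e : notUniformCheck n t l r N w = true) :
    ¬ IsUniformlySemiRationalGroup G := by
  rintro ⟨m, hm⟩
  have hN' : (N : ℤ) ≠ 0 := by exact_mod_cast hN
  have h0 := Int.emod_nonneg m hN'
  have hlt : (m % N).toNat < N := by
    have := Int.emod_lt_of_pos m (b := (N : ℤ)) (by omega)
    omega
  simp only [notUniformCheck, List.all_eq_true, List.mem_range, List.any_eq_true] at e
  obtain ⟨x, -, hx⟩ := e _ hlt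
  refine h.of_elemNegCheck_modEq ?_ hx (hm _)
  rw [Int.toNat_of_nonneg h0]
  exact (Int.mod_modEq _ _).symm

end IsMetacyclicPair

/-! ### The presented group has order `t * n` -/

section Presentation

variable {n t : ℕ}

/-- Left multiplication by `a` on the normal forms `b ^ j * a ^ i`. -/
def metacyclicPermA (n t : ℕ) (r : ℕ) : Equiv.Perm (ZMod t × ZMod n) where
  toFun p := (p.1, p.2 + (r : ZMod n) ^ p.1.val)
  invFun p := (p.1, p.2 - (r : ZMod n) ^ p.1.val)
  left_inv p := by simp
  right_inv p := by simp

/-- Left multiplication by `b` on the normal forms `b ^ j * a ^ i`. -/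
def metacyclicPermB (n t : ℕ) (l : ℕ) : Equiv.Perm (ZMod t × ZMod n) where
  toFun p := (p.1 + 1, p.2 + if t ∣ p.1.val + 1 then (l : ZMod n) else 0)
  invFun p := (p.1 - 1, p.2 - if t ∣ (p.1 - 1).val + 1 then (l : ZMod n) else 0)
  left_inv p := by simp
  right_inv p := by simp

theorem metacyclicPermA_pow_apply (r k : ℕ) (p : ZMod t × ZMod n) :
    (metacyclicPermA n t r ^ k) p = (p.1, p.2 + k * (r : ZMod n) ^ p.1.val) := by
  induction k with
  | zero => simp
  | succ k ih =>
    rw [pow_succ', Equiv.Perm.mul_apply, ih]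
    refine Prod.ext rfl ?_
    simp only [metacyclicPermA, Equiv.coe_fn_mk]
    push_cast
    ring

theorem metacyclicPermB_pow_apply [NeZero t] (l k : ℕ) (p : ZMod t × ZMod n) :
    (metacyclicPermB n t l ^ k) p = (p.1 + k, p.2 + l * ((p.1.val + k) / t : ℕ)) := by
  induction k with
  | zero => simp [Nat.div_eq_of_lt (ZMod.val_lt p.1)]
  | succ k ih =>
    rw [pow_succ', Equiv.Perm.mul_apply, ih]
    refine Prod.ext ?_ ?_
    · simp [metacyclicPermB, add_assoc]
    · have hiff : t ∣ (p.1 + (k : ZMod t)).val + 1 ↔ t ∣ p.1.val + k + 1 := by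
        rw [← ZMod.natCast_eq_zero_iff, ← ZMod.natCast_eq_zero_iff]
        simp
      simp only [metacyclicPermB, Equiv.coe_fn_mk, hiff, ← add_assoc, Nat.succ_div]
      split_ifs <;> push_cast <;> ring

theorem ZMod.val_add_one_modEq [NeZero t] (j : ZMod t) : (j + 1).val ≡ j.val + 1 [MOD t] := by
  rw [← ZMod.natCast_eq_natCast_iff]
  simp

theorem metacyclicPermA_mul_metacyclicPermB [NeZero t] {l r : ℕ} (h1 : r ^ t ≡ 1 [MOD n]) :
    metacyclicPermA n t r * metacyclicPermB n t l =
      metacyclicPermB n t l * metacyclicPermA n t r ^ r := by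
  ext p : 1
  rw [Equiv.Perm.mul_apply, Equiv.Perm.mul_apply, metacyclicPermA_pow_apply]
  have hr : (r : ZMod n) ^ t = 1 := by
    have := (ZMod.natCast_eq_natCast_iff _ _ _).2 h1
    simpa using this
  refine Prod.ext rfl ?_
  simp only [metacyclicPermA, metacyclicPermB, Equiv.coe_fn_mk]
  -- At the wrap-around from `t - 1` to `0` the exponent of `r` drops by `t`, which is harmless
  -- because `r ^ t = 1` in `ZMod n`.
  rw [pow_eq_pow_of_modEq (ZMod.val_add_one_modEq p.1) hr, pow_succ]
  ring

theorem metacyclicPermB_pow [NeZero t] {l r : ℕ} (h2 : l * r ≡ l [MOD n]) :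
    metacyclicPermB n t l ^ t = metacyclicPermA n t r ^ l := by
  ext p : 1
  rw [metacyclicPermA_pow_apply, metacyclicPermB_pow_apply]
  -- `a ^ l` adds `l * r ^ j` at first coordinate `j`, whereas `b ^ t` wraps around once and adds
  -- `l`. The condition `l * r ≡ l` makes these agree.
  have hl : ∀ k : ℕ, (l : ZMod n) * (r : ZMod n) ^ k = l := by
    have h3 : (l : ZMod n) * r = l := by
      have := (ZMod.natCast_eq_natCast_iff _ _ _).2 h2
      simpa using this
    intro k
    induction k with
    | zero => simp
    | succ k ih => rw [pow_succ, ← mul_assoc, ih, h3]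
  have ht : (p.1.val + t) / t = 1 := by
    rw [Nat.add_div_right _ (NeZero.pos t), Nat.div_eq_of_lt (ZMod.val_lt p.1)]
  refine Prod.ext ?_ ?_
  · simp
  · simp [hl, ht]

theorem metacyclicPermA_pow (r : ℕ) : metacyclicPermA n t r ^ n = 1 := by
  ext p : 1
  rw [metacyclicPermA_pow_apply]
  simp

/-- The homomorphism from the presented group given by elements that satisfy the relations. -/
def MetacyclicGroup.lift {G : Type*} [Group G] {n t l r : ℕ} {a b : G} (hn : a ^ n = 1)
    (ht : b ^ t = a ^ l) (hab : a * b = b * a ^ r) : MetacyclicGroup n t l r →* G :=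
  PresentedGroup.toGroup (f := ![a, b]) (by
    rintro x (rfl | rfl | rfl)
    · simpa using hn
    · simp [ht]
    · suffices b⁻¹ * a * b * (a ^ r)⁻¹ = 1 by simpa using this
      rw [mul_assoc b⁻¹, hab]
      group)

theorem MetacyclicGroup.lift_of_zero {G : Type*} [Group G] {n t l r : ℕ} {a b : G}
    (hn : a ^ n = 1) (ht : b ^ t = a ^ l) (hab : a * b = b * a ^ r) :
    MetacyclicGroup.lift hn ht hab (PresentedGroup.of 0) = a := by
  rw [MetacyclicGroup.lift, PresentedGroup.toGroup.of]; rfl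

theorem MetacyclicGroup.lift_of_one {G : Type*} [Group G] {n t l r : ℕ} {a b : G}
    (hn : a ^ n = 1) (ht : b ^ t = a ^ l) (hab : a * b = b * a ^ r) :
    MetacyclicGroup.lift hn ht hab (PresentedGroup.of 1) = b := by
  rw [MetacyclicGroup.lift, PresentedGroup.toGroup.of]; rfl

/-- Normal forms are closed under products and inverses, so they exhaust the group. They are
distinct because the presented group acts on `ZMod t × ZMod n` by the permutations above, and `b ^ j
* a ^ i` sends `(0, 0)` to `(j, i)`. -/
theorem MetacyclicGroup.isMetacyclicPair {n t l r : ℕ} (hn : 0 < n) (ht : 0 < t) (hr : 0 < r)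
    (h1 : r ^ t ≡ 1 [MOD n]) (h2 : l * r ≡ l [MOD n]) :
    IsMetacyclicPair n t l r (PresentedGroup.of 0 : MetacyclicGroup n t l r)
      (PresentedGroup.of 1) := by
  set a : MetacyclicGroup n t l r := PresentedGroup.of 0 with ha
  set b : MetacyclicGroup n t l r := PresentedGroup.of 1 with hb
  have ra : a ^ n = 1 := PresentedGroup.one_of_mem (rels := metacyclicRels n t l r) (Or.inl rfl)
  have rb : b ^ t = a ^ l := mul_inv_eq_one.1
    (PresentedGroup.one_of_mem (rels := metacyclicRels n t l r) (Or.inr (Or.inl rfl)))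
  have rab : b⁻¹ * a * b = a ^ r := mul_inv_eq_one.1
    (PresentedGroup.one_of_mem (rels := metacyclicRels n t l r) (Or.inr (Or.inr rfl)))
  have hab : a * b = b * a ^ r := by rw [← rab]; group
  have : NeZero t := ⟨ht.ne'⟩
  have : NeZero n := ⟨hn.ne'⟩
  have hbtn : b ^ (t * n) = 1 := by rw [pow_mul, rb, ← pow_mul, mul_comm, pow_mul, ra, one_pow]
  have hex : ∀ g : MetacyclicGroup n t l r, ∃ j i : ℕ, b ^ j * a ^ i = g := by
    intro g
    have hg : g ∈ Subgroup.closure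
        (Set.range (PresentedGroup.of : Fin 2 → MetacyclicGroup n t l r)) := by
      rw [PresentedGroup.closure_range_of]; trivial
    induction hg using Subgroup.closure_induction with
    | mem x hx =>
      obtain ⟨k, rfl⟩ := hx
      fin_cases k
      · exact ⟨0, 1, by simp [ha]⟩
      · exact ⟨1, 0, by simp [hb]⟩
    | one => exact ⟨0, 0, by simp⟩
    | mul x y _ _ hx hy =>
      obtain ⟨j, i, rfl⟩ := hx
      obtain ⟨s, k, rfl⟩ := hy
      exact ⟨_, _, (mul_pow_mul_pow_of_mul_eq hab j i s k).symm⟩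
    | inv x _ hx =>
      obtain ⟨j, i, rfl⟩ := hx
      have e1 : (a ^ i)⁻¹ = b ^ 0 * a ^ (i * (n - 1)) := by
        rw [pow_zero, one_mul, inv_eq_iff_mul_eq_one, ← pow_add]
        have : i + i * (n - 1) = n * i := by
          obtain ⟨m, rfl⟩ := Nat.exists_eq_succ_of_ne_zero hn.ne'
          simp; ring
        rw [this, pow_mul, ra, one_pow]
      have e2 : (b ^ j)⁻¹ = b ^ (j * (t * n - 1)) * a ^ 0 := by
        rw [pow_zero, mul_one, inv_eq_iff_mul_eq_one, ← pow_add]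
        have : j + j * (t * n - 1) = t * n * j := by
          obtain ⟨m, hm⟩ := Nat.exists_eq_succ_of_ne_zero (Nat.mul_pos ht hn).ne'
          rw [hm]; simp; ring
        rw [this, pow_mul, hbtn, one_pow]
      rw [mul_inv_rev, e1, e2]
      exact ⟨_, _, (mul_pow_mul_pow_of_mul_eq hab _ _ _ _).symm⟩
  refine ⟨hn, ht, hr, h1, h2, ra, rb, hab, fun g => ?_, ?_⟩
  · obtain ⟨j, i, rfl⟩ := hex g
    refine ⟨j % t, Nat.mod_lt _ ht, (i + l * (j / t)) % n, Nat.mod_lt _ hn, ?_⟩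
    rw [← pow_eq_pow_of_modEq (Nat.mod_modEq (i + l * (j / t)) n).symm ra, add_comm i, pow_add,
      pow_mul a l, ← rb, ← mul_assoc, ← pow_mul, ← pow_add, Nat.mod_add_div]
  · intro j hj i hi j' hj' i' hi' e
    have key : ∀ j < t, ∀ i < n, MetacyclicGroup.lift (metacyclicPermA_pow r)
        (metacyclicPermB_pow h2) (metacyclicPermA_mul_metacyclicPermB h1) (b ^ j * a ^ i) (0, 0) =
        ((j : ZMod t), (i : ZMod n)) := by
      intro j hj i hi
      rw [map_mul, map_pow, map_pow, MetacyclicGroup.lift_of_zero, MetacyclicGroup.lift_of_one,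
        Equiv.Perm.mul_apply, metacyclicPermA_pow_apply, metacyclicPermB_pow_apply]
      simp [Nat.div_eq_of_lt hj]
    have e1 := key j hj i hi
    rw [e, key j' hj' i' hi', Prod.mk.injEq, ZMod.natCast_eq_natCast_iff,
      ZMod.natCast_eq_natCast_iff] at e1
    exact ⟨(Nat.ModEq.eq_of_lt_of_lt e1.1 hj' hj).symm,
      (Nat.ModEq.eq_of_lt_of_lt e1.2 hi' hi).symm⟩

end Presentation

/-! ### Recognising isomorphisms and bounding the parameters -/

namespace IsMetacyclicPair

variable {G : Type*} [Group G] {n t l r : ℕ} {a b : G}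

/-- The relations give a homomorphism from the presented group to `G`. It is onto because `a` and
`b` lie in the subgroup generated by `a'` and `b'`, and equality of the orders makes it bijective.
-/
theorem nonempty_mulEquiv (h : IsMetacyclicPair n t l r a b) {n' t' l' r' : ℕ} {a' b' : G}
    (hn : 0 < n') (ht : 0 < t') (hr : 0 < r') (h1 : r' ^ t' ≡ 1 [MOD n'])
    (h2 : l' * r' ≡ l' [MOD n']) (hcard : t' * n' = t * n) (ra : a' ^ n' = 1)
    (rb : b' ^ t' = a' ^ l') (hab : a' * b' = b' * a' ^ r')
    (ha : a ∈ Subgroup.closure {a', b'}) (hb : b ∈ Subgroup.closure {a', b'}) :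
    Nonempty (G ≃* MetacyclicGroup n' t' l' r') := by
  have h' := MetacyclicGroup.isMetacyclicPair (l := l') hn ht hr h1 h2
  have := h'.finite
  let f := MetacyclicGroup.lift ra rb hab
  have hle : Subgroup.closure {a', b'} ≤ f.range := by
    rw [Subgroup.closure_le]
    rintro x (rfl | rfl)
    · exact ⟨_, MetacyclicGroup.lift_of_zero ra rb hab⟩
    · exact ⟨_, MetacyclicGroup.lift_of_one ra rb hab⟩
  have hsurj : Function.Surjective f := by
    intro g
    obtain ⟨j, -, i, -, rfl⟩ := h.exists_eq g
    exact f.range.mul_mem (f.range.pow_mem (hle hb) j) (f.range.pow_mem (hle ha) i)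
  have hbij := hsurj.bijective_of_nat_card_le (by rw [h'.natCard_eq, h.natCard_eq, hcard])
  exact ⟨(MulEquiv.ofBijective f hbij).symm⟩

/-- The exponent of `b` modulo `t` is a conjugacy invariant, so two classes provide at most two
residues. Every residue coprime to `t` is needed. -/
theorem totient_t_le (h : IsMetacyclicPair n t l r a b) (hb : IsSemiRationalElement b) :
    t.totient ≤ 2 := by
  obtain ⟨u, v, huv⟩ := hb
  obtain ⟨ju, hju, iu, -, rfl⟩ := h.exists_eq u
  obtain ⟨jv, hjv, iv, -, rfl⟩ := h.exists_eq v
  have hN : b ^ (t * n) = 1 := by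
    rw [pow_mul, h.pow_t, ← pow_mul, mul_comm, pow_mul, h.pow_n, one_pow]
  have key : ∀ k' : ℕ, ∀ j < t, ∀ i, IsConj (b ^ j * a ^ i) (b ^ k') → j = k' % t := by
    intro k' j hj i hc
    have e := h.pow_mul_pow_eq k' 0
    rw [pow_zero, mul_one] at e
    rw [e] at hc
    exact (h.exists_modEq_of_isConj hj (Nat.mod_lt _ h.t_pos) hc).1
  have hsub : (Finset.range t).filter t.Coprime ⊆ {ju, jv} := by
    intro k hk
    rw [Finset.mem_filter, Finset.mem_range] at hk
    -- The order of `b` may exceed `t`, so `k` is lifted to an exponent coprime to `t * n` to obtain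
    -- a generator of `⟨b⟩`.
    obtain ⟨k', -, hc, hm⟩ := Nat.exists_coprime_modEq hk.2.symm (Dvd.intro n rfl)
      (Nat.mul_pos h.t_pos h.n_pos).ne'
    have hkk : k' % t = k := by rw [hm, Nat.mod_eq_of_lt hk.1]
    rw [Finset.mem_insert, Finset.mem_singleton]
    rcases huv _ (zpowers_pow_eq_zpowers hN hc) with h1 | h1
    · left; rw [key k' ju hju iu h1, hkk]
    · right; rw [key k' jv hjv iv h1, hkk]
  exact (Finset.card_le_card hsub).trans Finset.card_le_two

open Classical in
-- The conjugates of `a ^ k₀` are the powers `a ^ (k₀ * r ^ s)` with `s < t`, so each of the two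
-- classes contains at most `t` of the `φ n` generators `a ^ k`.
theorem totient_n_le (h : IsMetacyclicPair n t l r a b) (ha : IsSemiRationalElement a) :
    n.totient ≤ 2 * t := by
  obtain ⟨u, v, huv⟩ := ha
  have key : ∀ w : G, ((Finset.range n).filter fun k => IsConj w (a ^ k)).card ≤ t := by
    intro w
    rcases Finset.eq_empty_or_nonempty ((Finset.range n).filter fun k => IsConj w (a ^ k)) with
      h0 | ⟨k₀, hk₀⟩
    · rw [h0]; simp
    · rw [Finset.mem_filter] at hk₀
      have hsub : ((Finset.range n).filter fun k => IsConj w (a ^ k)) ⊆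
          (Finset.range t).image fun s => k₀ * r ^ s % n := by
        intro k hk
        rw [Finset.mem_filter, Finset.mem_range] at hk
        have hc : IsConj (b ^ 0 * a ^ k₀) (b ^ 0 * a ^ k) := by
          simpa using hk₀.2.symm.trans hk.2
        obtain ⟨-, s, hs, e⟩ := h.exists_modEq_of_isConj h.t_pos h.t_pos hc
        rw [pow_zero, Nat.sub_self, Nat.gcd_zero_right] at e
        exact Finset.mem_image.2 ⟨s, Finset.mem_range.2 hs, by rw [e, Nat.mod_eq_of_lt hk.1]⟩
      exact (Finset.card_le_card hsub).trans (Finset.card_image_le.trans (by simp))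
  have hsub : (Finset.range n).filter n.Coprime ⊆
      ((Finset.range n).filter fun k => IsConj u (a ^ k)) ∪
        (Finset.range n).filter fun k => IsConj v (a ^ k) := by
    intro k hk
    rw [Finset.mem_filter] at hk
    rw [Finset.mem_union, Finset.mem_filter, Finset.mem_filter]
    exact (huv _ (zpowers_pow_eq_zpowers h.pow_n hk.2.symm)).imp (⟨hk.1, ·⟩) (⟨hk.1, ·⟩)
  refine (Finset.card_le_card hsub).trans ((Finset.card_union_le _ _).trans ?_)
  rw [two_mul]
  exact add_le_add (key u) (key v)

end IsMetacyclicPair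

/-! ### Numbers with small totient -/

/-- Both bounds are proved together by multiplicativity: of two coprime factors at most one is even,
so the factor 2 is lost at most once. -/
theorem Nat.le_totient_sq (n : ℕ) :
    n ≤ 2 * n.totient ^ 2 ∧ (Odd n → n ≤ n.totient ^ 2) := by
  induction n using Nat.recOnPosPrimePosCoprime with
  | zero => simp
  | one => simp
  | prime_pow p k hp hk =>
    obtain ⟨k, rfl⟩ := Nat.exists_eq_succ_of_ne_zero hk.ne'
    rw [Nat.totient_prime_pow_succ hp]
    have hpk : 1 ≤ p ^ k := Nat.pow_pos hp.pos
    obtain ⟨q, rfl⟩ := Nat.exists_eq_add_of_le hp.two_le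
    have e : 2 + q - 1 = q + 1 := by omega
    rw [e, Nat.succ_eq_add_one, pow_succ]
    generalize (2 + q) ^ k = P at *
    have h2 : 2 * (P * (q + 1)) ^ 2 = P * (P * (2 * (q + 1) ^ 2)) := by ring
    have h3 : (P * (q + 1)) ^ 2 = P * (P * (q + 1) ^ 2) := by ring
    constructor
    · rw [h2]
      exact Nat.mul_le_mul_left _ (by nlinarith)
    · intro hodd
      have hq : q ≠ 0 := by
        rintro rfl
        rw [Nat.odd_mul] at hodd
        exact absurd hodd.2 (by decide)
      have : 1 ≤ q := Nat.one_le_iff_ne_zero.2 hq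
      rw [h3]
      exact Nat.mul_le_mul_left _ (by nlinarith)
  | coprime m n hm hn hc ihm ihn =>
    rw [Nat.totient_mul hc, mul_pow]
    constructor
    · rcases Nat.even_or_odd m with h | h
      · have hn' : Odd n := Nat.not_even_iff_odd.1 fun h' =>
          absurd (hc ▸ Nat.dvd_gcd h.two_dvd h'.two_dvd) (by decide)
        calc m * n ≤ (2 * m.totient ^ 2) * n.totient ^ 2 := Nat.mul_le_mul ihm.1 (ihn.2 hn')
          _ = _ := by ring
      · calc m * n ≤ m.totient ^ 2 * (2 * n.totient ^ 2) := Nat.mul_le_mul (ihm.2 h) ihn.1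
          _ = _ := by ring
    · intro h
      rw [Nat.odd_mul] at h
      exact Nat.mul_le_mul (ihm.2 h.1) (ihn.2 h.2)

theorem Nat.totient_eq_countP (n : ℕ) :
    n.totient = (List.range n).countP fun k => (n.gcd k).beq 1 := by
  rw [Nat.totient, Finset.card, Finset.filter_val, Finset.range_val, Multiset.range,
    ← Multiset.countP_eq_card_filter, Multiset.coe_countP]
  congr 1
  ext k
  rw [Bool.eq_iff_iff, Nat.beq_eq, decide_eq_true_iff, Nat.Coprime]

/-- The numbers `n > 1` with `φ n ≤ 12`. -/
def smallTotientList : List ℕ :=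
  [2, 3, 4, 5, 6, 7, 8, 9, 10, 11, 12, 13, 14, 15, 16, 18, 20, 21, 22, 24, 26, 28, 30, 36, 42]

theorem mem_smallTotientList {n : ℕ} (hn : 1 < n) (h : n.totient ≤ 12) :
    n ∈ smallTotientList := by
  -- The bound is `2 * 12 ^ 2 + 1`.
  have hlt : n < 289 := by
    have := (Nat.le_totient_sq n).1
    nlinarith
  have key : ((List.range 289).all fun n => smallTotientList.elem n || (n.ble 1 ||
      Nat.ble 13 ((List.range n).countP fun k => (n.gcd k).beq 1))) = true := by
    decide +kernel
  rw [List.all_eq_true] at key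
  have := key n (List.mem_range.2 hlt)
  rw [← Nat.totient_eq_countP] at this
  simp only [Bool.or_eq_true, Nat.ble_eq, List.elem_iff] at this
  rcases this with h1 | h1 | h1
  · exact h1
  · omega
  · omega

/-! ### Finite verification -/

/-- Entries `((n, t, l, r), (n', t', l', r'), (j, s, α, β))`: in the group with parameters
`(n, t, l, r)`, the elements `a' = b ^ j * a` and `b' = b ^ s` satisfy the relations for
`(n', t', l', r')`, and `a = b' ^ α * a' ^ β`, `b = b' ^ s`. -/
def isoList : List ((ℕ × ℕ × ℕ × ℕ) × (ℕ × ℕ × ℕ × ℕ) × (ℕ × ℕ × ℕ × ℕ)) :=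
  [((5, 2, 5, 4), (5, 2, 5, 4), (0, 1, 0, 1)),
   ((8, 2, 4, 7), (8, 2, 4, 7), (0, 1, 0, 1)),
   ((8, 2, 8, 7), (8, 2, 8, 7), (0, 1, 0, 1)),
   ((10, 2, 5, 9), (10, 2, 5, 9), (0, 1, 0, 1)),
   ((10, 2, 10, 9), (10, 2, 10, 9), (0, 1, 0, 1)),
   ((12, 2, 6, 11), (12, 2, 6, 11), (0, 1, 0, 1)),
   ((12, 2, 12, 11), (12, 2, 12, 11), (0, 1, 0, 1)),
   ((5, 4, 5, 4), (10, 2, 5, 9), (2, 1, 0, 6)),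
   ((8, 4, 4, 3), (8, 4, 4, 3), (0, 1, 0, 1)),
   ((8, 4, 4, 7), (8, 4, 4, 3), (2, 1, 2, 5)),
   ((8, 4, 8, 7), (8, 4, 8, 7), (0, 1, 0, 1)),
   ((10, 4, 10, 9), (10, 4, 10, 9), (0, 1, 0, 1)),
   ((12, 4, 6, 11), (12, 4, 6, 11), (0, 1, 0, 1)),
   ((12, 4, 12, 11), (12, 4, 12, 11), (0, 1, 0, 1)),
   ((13, 6, 13, 4), (13, 6, 13, 4), (0, 1, 0, 1)),
   ((13, 6, 13, 10), (13, 6, 13, 4), (0, 5, 0, 1)),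
   ((21, 6, 21, 5), (21, 6, 21, 5), (0, 1, 0, 1)),
   ((21, 6, 21, 17), (21, 6, 21, 5), (0, 5, 0, 1)),
   ((26, 6, 26, 17), (26, 6, 26, 17), (0, 1, 0, 1)),
   ((26, 6, 26, 23), (26, 6, 26, 17), (0, 5, 0, 1)),
   ((28, 6, 14, 3), (28, 6, 14, 3), (0, 1, 0, 1)),
   ((28, 6, 28, 3), (28, 6, 28, 3), (0, 1, 0, 1)),
   ((28, 6, 14, 19), (28, 6, 14, 3), (0, 5, 0, 1)),
   ((28, 6, 28, 19), (28, 6, 28, 3), (0, 5, 0, 1)),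
   ((42, 6, 42, 5), (42, 6, 42, 5), (0, 1, 0, 1)),
   ((42, 6, 42, 17), (42, 6, 42, 5), (0, 5, 0, 1))]

/-- Tests that the parameters define a metacyclic group of order `t * n`. -/
def relCheck (n t l r : ℕ) : Bool :=
  Nat.ble 1 n && (Nat.ble 1 t && (Nat.ble 1 r &&
    ((r ^ t % n).beq (1 % n) && (l * r % n).beq (l % n))))

/-- Tests an entry of `isoList`. -/
def isoCheck (n t l r n' t' l' r' j s α β : ℕ) : Bool :=
  relCheck n' t' l' r' && ((t' * n').beq (t * n) &&
    (eqCheck n t l (j * n') (geomSum (r ^ j) n') 0 0 &&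
    (eqCheck n t l (s * t') 0 (j * l') (geomSum (r ^ j) l') &&
    (eqCheck n t l (j + s) (r ^ s) (s + j * r') (geomSum (r ^ j) r') &&
    (eqCheck n t l (s * α + j * β) (geomSum (r ^ j) β) 0 1 &&
    eqCheck n t l (s * s) 0 1 0)))))

theorem MetacyclicGroup.isMetacyclicPair_of_relCheck {n t l r : ℕ}
    (e : relCheck n t l r = true) :
    IsMetacyclicPair n t l r (PresentedGroup.of 0 : MetacyclicGroup n t l r)
      (PresentedGroup.of 1) := by
  simp only [relCheck, Bool.and_eq_true, Nat.beq_eq, Nat.ble_eq] at e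
  exact MetacyclicGroup.isMetacyclicPair e.1 e.2.1 e.2.2.1 e.2.2.2.1 e.2.2.2.2

theorem IsMetacyclicPair.nonempty_mulEquiv_of_isoCheck {G : Type*} [Group G] {n t l r : ℕ}
    {a b : G} (h : IsMetacyclicPair n t l r a b) {n' t' l' r' j s α β : ℕ}
    (e : isoCheck n t l r n' t' l' r' j s α β = true) :
    Nonempty (G ≃* MetacyclicGroup n' t' l' r') := by
  rw [isoCheck, Bool.and_eq_true, Bool.and_eq_true, Bool.and_eq_true, Bool.and_eq_true,
    Bool.and_eq_true, Bool.and_eq_true, Nat.beq_eq] at e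
  obtain ⟨e0, hcard, e1, e2, e3, e4, e5⟩ := e
  simp only [relCheck, Bool.and_eq_true, Nat.beq_eq, Nat.ble_eq] at e0
  have hp : ∀ k, (b ^ j * a) ^ k = b ^ (j * k) * a ^ geomSum (r ^ j) k := by
    intro k
    have := h.pow_eq_geomSum j 1 k
    rwa [pow_one, one_mul] at this
  have ha' : b ^ j * a ∈ Subgroup.closure {b ^ j * a, b ^ s} := Subgroup.subset_closure (by simp)
  have hb' : b ^ s ∈ Subgroup.closure {b ^ j * a, b ^ s} := Subgroup.subset_closure (by simp)
  refine h.nonempty_mulEquiv (a' := b ^ j * a) (b' := b ^ s) e0.1 e0.2.1 e0.2.2.1 e0.2.2.2.1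
    e0.2.2.2.2 hcard ?_ ?_ ?_ ?_ ?_
  · rw [hp, h.eq_of_eqCheck e1, pow_zero, pow_zero, one_mul]
  · rw [hp, ← h.eq_of_eqCheck e2, pow_zero, mul_one, pow_mul]
  · have := mul_pow_mul_pow_of_mul_eq h.mul_eq j 1 s 0
    rw [pow_one, pow_zero, mul_one, one_mul, add_zero] at this
    rw [this, h.eq_of_eqCheck e3, hp, pow_add, mul_assoc]
  · have := h.eq_of_eqCheck e4
    rw [pow_zero, one_mul, pow_one] at this
    rw [pow_add, mul_assoc, ← hp, pow_mul] at this
    have hs := mul_mem (pow_mem hb' α) (pow_mem ha' β)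
    rwa [this] at hs
  · have := h.eq_of_eqCheck e5
    rw [pow_zero, mul_one, mul_one, pow_one, pow_mul] at this
    have hs := pow_mem hb' s
    rwa [this] at hs

/-- Tests that the parameters occur in `isoList` or the group is not semi-rational or it is inverse
semi-rational. -/
def mainCheck (n t l r : ℕ) : Bool :=
  (isoList.any fun c =>
    c.1.1.beq n && (c.1.2.1.beq t && (c.1.2.2.1.beq l && c.1.2.2.2.beq r))) ||
  (notSemiCheck n t l r 0 1 (elemOrder n t l r 0 1) ||
  (notSemiCheck n t l r 1 0 (elemOrder n t l r 1 0) ||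
  (notSemiCheck n t l r 2 1 (elemOrder n t l r 2 1) ||
  (notSemiCheck n t l r 1 1 (elemOrder n t l r 1 1) || invCheck n t l r))))

/-- Runs `mainCheck` on all relevant `l` and `r`. -/
def paramCheck (n t : ℕ) : Bool :=
  (List.range n).all fun r => r.beq 1 || (!(r ^ t % n).beq (1 % n) ||
    (List.range (n + 1)).all fun l => l.beq 0 || (!(n % l).beq 0 ||
      (!(l * r % n).beq (l % n) || mainCheck n t l r)))

theorem paramCheck_two : (smallTotientList.all fun n => paramCheck n 2) = true := by
  decide +kernel

theorem paramCheck_three : (smallTotientList.all fun n => paramCheck n 3) = true := by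
  decide +kernel

theorem paramCheck_four : (smallTotientList.all fun n => paramCheck n 4) = true := by
  decide +kernel

theorem paramCheck_six : (smallTotientList.all fun n => paramCheck n 6) = true := by
  decide +kernel

theorem isoCheck_of_mem : ∀ c ∈ isoList,
    isoCheck c.1.1 c.1.2.1 c.1.2.2.1 c.1.2.2.2 c.2.1.1 c.2.1.2.1 c.2.1.2.2.1 c.2.1.2.2.2
      c.2.2.1 c.2.2.2.1 c.2.2.2.2.1 c.2.2.2.2.2 = true := by
  decide +kernel

theorem target_mem : ∀ c ∈ isoList,
    (∃ e ∈ uniformList, (e.1, e.2.1, e.2.2.1, e.2.2.2.1) = c.2.1) ∨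
      c.2.1 = (8, 4, 4, 3) ∨ c.2.1 = (12, 4, 6, 11) := by
  decide +kernel

theorem uniformList_check : ∀ e ∈ uniformList, relCheck e.1 e.2.1 e.2.2.1 e.2.2.2.1 = true ∧
    0 ≤ e.2.2.2.2 ∧
    groupCheck e.1 e.2.1 e.2.2.1 e.2.2.2.1
      (fun j i N => elemCheck e.1 e.2.1 e.2.2.1 e.2.2.2.1 j i N e.2.2.2.2.toNat) = true ∧
    -- The element `a`, with `N = n` and `m = n - 1`, already refutes inverse semi-rationality in
    -- all sixteen groups.
    elemNegCheck e.1 e.2.1 e.2.2.1 e.2.2.2.1 0 1 e.1 (e.1 - 1) = true := by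
  decide +kernel

theorem uniformList_spec {n t l r : ℕ} {m : ℤ} (he : (n, t, l, r, m) ∈ uniformList) :
    IsMSemiRationalGroup m (MetacyclicGroup n t l r) ∧
      ¬ IsInverseSemiRationalGroup (MetacyclicGroup n t l r) := by
  obtain ⟨h0, hm, h1, h2⟩ := uniformList_check _ he
  have h := MetacyclicGroup.isMetacyclicPair_of_relCheck h0
  constructor
  · have := h.isMSemiRationalGroup h1
    rwa [Int.toNat_of_nonneg hm] at this
  · intro hinv
    refine h.of_elemNegCheck_modEq (m' := -1) ?_ h2 fun y hy => ?_
    · rw [Nat.cast_sub h.n_pos, Int.modEq_iff_dvd]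
      simp
    · rw [zpow_neg_one]
      exact hinv _ y hy

theorem isSemiRationalGroup_8_4_4_3 : IsSemiRationalGroup (MetacyclicGroup 8 4 4 3) :=
  (MetacyclicGroup.isMetacyclicPair_of_relCheck (by decide +kernel)).isSemiRationalGroup
    (by decide +kernel)

theorem isSemiRationalGroup_12_4_6_11 : IsSemiRationalGroup (MetacyclicGroup 12 4 6 11) :=
  (MetacyclicGroup.isMetacyclicPair_of_relCheck (by decide +kernel)).isSemiRationalGroup
    (by decide +kernel)

/-- For each residue of `m` modulo 8, one of `a`, `b`, `b ^ 2 * a` has a generator of its cyclic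
subgroup outside the two permitted classes. -/
theorem not_isUniformlySemiRationalGroup_8_4_4_3 :
    ¬ IsUniformlySemiRationalGroup (MetacyclicGroup 8 4 4 3) :=
  (MetacyclicGroup.isMetacyclicPair_of_relCheck
    (by decide +kernel)).not_isUniformlySemiRationalGroup (N := 8) (w := [(0, 1), (1, 0), (2, 1)])
      (by decide) (by decide +kernel)

/-- The obstructing elements are now `a`, `b ^ 2`, `b ^ 2 * a`, and `m` runs modulo 12. -/
theorem not_isUniformlySemiRationalGroup_12_4_6_11 :
    ¬ IsUniformlySemiRationalGroup (MetacyclicGroup 12 4 6 11) :=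
  (MetacyclicGroup.isMetacyclicPair_of_relCheck
    (by decide +kernel)).not_isUniformlySemiRationalGroup (N := 12) (w := [(0, 1), (2, 0), (2, 1)])
      (by decide) (by decide +kernel)

theorem not_nonempty_mulEquiv_exceptional :
    ¬ Nonempty (MetacyclicGroup 8 4 4 3 ≃* MetacyclicGroup 12 4 6 11) := by
  rintro ⟨f⟩
  have h1 := Nat.card_congr f.toEquiv
  rw [(MetacyclicGroup.isMetacyclicPair_of_relCheck (by decide +kernel)).natCard_eq,
    (MetacyclicGroup.isMetacyclicPair_of_relCheck (by decide +kernel)).natCard_eq] at h1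
  -- The orders are 32 and 48.
  exact absurd h1 (by decide)

/-! ### Invariance under isomorphism -/

section Transfer

variable {G H : Type*} [Group G] [Group H]

theorem MulEquiv.isConj_iff_map (f : G ≃* H) {x y : G} : IsConj (f x) (f y) ↔ IsConj x y := by
  refine ⟨fun h => ?_, fun h => f.toMonoidHom.map_isConj h⟩
  simpa using f.symm.toMonoidHom.map_isConj h

theorem MulEquiv.zpowers_map_eq (f : G ≃* H) {x y : G}
    (h : Subgroup.zpowers y = Subgroup.zpowers x) :
    Subgroup.zpowers (f y) = Subgroup.zpowers (f x) := by
  have hx := MonoidHom.map_zpowers f.toMonoidHom x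
  have hy := MonoidHom.map_zpowers f.toMonoidHom y
  rw [h] at hy
  exact hy.symm.trans hx

theorem IsMSemiRationalGroup.of_mulEquiv {m : ℤ} (f : G ≃* H) (h : IsMSemiRationalGroup m H) :
    IsMSemiRationalGroup m G := by
  intro x y hy
  have := h (f x) (f y) (f.zpowers_map_eq hy)
  rwa [← map_zpow, f.isConj_iff_map, f.isConj_iff_map] at this

theorem IsSemiRationalGroup.of_mulEquiv (f : G ≃* H) (h : IsSemiRationalGroup H) :
    IsSemiRationalGroup G := by
  intro x
  obtain ⟨u, v, huv⟩ := h (f x)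
  refine ⟨f.symm u, f.symm v, fun y hy => ?_⟩
  have := huv (f y) (f.zpowers_map_eq hy)
  rwa [← f.isConj_iff_map, ← f.isConj_iff_map, f.apply_symm_apply, f.apply_symm_apply]

theorem IsMSemiRationalGroup.isSemiRationalGroup {m : ℤ} (h : IsMSemiRationalGroup m G) :
    IsSemiRationalGroup G :=
  fun x => ⟨x, x ^ m, h x⟩

theorem isMSemiRationalGroup_neg_one_iff :
    IsMSemiRationalGroup (-1) G ↔ IsInverseSemiRationalGroup G := by
  simp only [IsMSemiRationalGroup, IsInverseSemiRationalGroup, IsInverseSemiRationalElement,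
    zpow_neg_one]

theorem IsInUniformList.isUniformlySemiRationalGroup (h : IsInUniformList G) :
    IsUniformlySemiRationalGroup G := by
  obtain ⟨n, t, l, r, m, he, ⟨f⟩⟩ := h
  exact ⟨m, (uniformList_spec he).1.of_mulEquiv f⟩

theorem IsInExceptionalList.isSemiRationalGroup (h : IsInExceptionalList G) :
    IsSemiRationalGroup G := by
  rcases h with ⟨⟨f⟩⟩ | ⟨⟨f⟩⟩
  · exact isSemiRationalGroup_8_4_4_3.of_mulEquiv f
  · exact isSemiRationalGroup_12_4_6_11.of_mulEquiv f

theorem IsInExceptionalList.not_isUniformlySemiRationalGroup (h : IsInExceptionalList G) :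
    ¬ IsUniformlySemiRationalGroup G := by
  rintro ⟨m, hm⟩
  rcases h with ⟨⟨f⟩⟩ | ⟨⟨f⟩⟩
  · exact not_isUniformlySemiRationalGroup_8_4_4_3 ⟨m, hm.of_mulEquiv f.symm⟩
  · exact not_isUniformlySemiRationalGroup_12_4_6_11 ⟨m, hm.of_mulEquiv f.symm⟩

end Transfer

/-! ### The classification -/

namespace IsMetacyclicPair

variable {G : Type*} [Group G] {n t l r : ℕ} {a b : G}

theorem cases_of_mainCheck (h : IsMetacyclicPair n t l r a b) (hG : IsSemiRationalGroup G)
    (e : mainCheck n t l r = true) :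
    IsInverseSemiRationalGroup G ∨ IsInUniformList G ∨ IsInExceptionalList G := by
  simp only [mainCheck, Bool.or_eq_true, List.any_eq_true, Bool.and_eq_true, Nat.beq_eq] at e
  rcases e with ⟨⟨⟨n₁, t₁, l₁, r₁⟩, ⟨n', t', l', r'⟩, ⟨j, s, α, β⟩⟩, hc, rfl, rfl, rfl, rfl⟩ |
    e | e | e | e | e
  · right
    have f := h.nonempty_mulEquiv_of_isoCheck (isoCheck_of_mem _ hc)
    rcases target_mem _ hc with ⟨⟨n₂, t₂, l₂, r₂, m⟩, he, e'⟩ | e' | e'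
    · left
      simp only [Prod.mk.injEq] at e'
      obtain ⟨rfl, rfl, rfl, rfl⟩ := e'
      exact ⟨_, _, _, _, m, he, f⟩
    all_goals
      right
      simp only [Prod.mk.injEq] at e'
      obtain ⟨rfl, rfl, rfl, rfl⟩ := e'
    · exact Or.inl f
    · exact Or.inr f
  · exact absurd (hG _) (h.of_notSemiCheck e)
  · exact absurd (hG _) (h.of_notSemiCheck e)
  · exact absurd (hG _) (h.of_notSemiCheck e)
  · exact absurd (hG _) (h.of_notSemiCheck e)
  · exact Or.inl (isMSemiRationalGroup_neg_one_iff.1 (h.isMSemiRationalGroup_neg_one e))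

theorem cases_of_isSemiRationalGroup (h : IsMetacyclicPair n t l r a b) (hl : l ∣ n)
    (hG : IsSemiRationalGroup G) (hab : ¬ ∀ x y : G, x * y = y * x) :
    IsInverseSemiRationalGroup G ∨ IsInUniformList G ∨ IsInExceptionalList G := by
  have hr1 : ¬ r ≡ 1 [MOD n] := fun e => hab (h.mul_comm_of_modEq e)
  have hn : 1 < n := by
    rcases Nat.lt_or_ge 1 n with h1 | h1
    · exact h1
    · obtain rfl : n = 1 := le_antisymm h1 h.n_pos
      exact absurd (Nat.modEq_one) hr1
  -- `r ^ t ≡ 1` with `n > 1` excludes `r ≡ 0`.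
  have hr0 : 0 < r % n := by
    rw [Nat.pos_iff_ne_zero]
    intro h0
    have e1 : r ^ t ≡ 0 ^ t [MOD n] := Nat.ModEq.pow t (by rw [Nat.ModEq, h0, Nat.zero_mod])
    rw [zero_pow h.t_pos.ne'] at e1
    have e2 := h.pow_modEq.symm.trans e1
    rw [Nat.ModEq, Nat.mod_eq_of_lt hn, Nat.zero_mod] at e2
    exact one_ne_zero e2
  have ht := h.totient_t_le (hG b)
  -- From `t ≤ 2 * φ t ^ 2` and `φ t ≤ 2`.
  have ht8 : t ≤ 8 := by
    have := (Nat.le_totient_sq t).1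
    nlinarith
  have ht' : t = 2 ∨ t = 3 ∨ t = 4 ∨ t = 6 := by
    have h1 : t ≠ 1 := by
      rintro rfl
      exact hr1 (by simpa using h.pow_modEq)
    have h0 := h.t_pos
    interval_cases t
    · exact absurd rfl h1
    · simp
    · simp
    · simp
    · exact absurd ht (by decide)
    · simp
    · exact absurd ht (by decide)
    · exact absurd ht (by decide)
  have hmem := mem_smallTotientList hn ((h.totient_n_le (hG a)).trans (by omega))
  have hcheck : paramCheck n t = true := by
    rcases ht' with rfl | rfl | rfl | rfl
    · exact List.all_eq_true.1 paramCheck_two n hmem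
    · exact List.all_eq_true.1 paramCheck_three n hmem
    · exact List.all_eq_true.1 paramCheck_four n hmem
    · exact List.all_eq_true.1 paramCheck_six n hmem
  have h' := h.mod hr0
  refine h'.cases_of_mainCheck hG ?_
  simp only [paramCheck, List.all_eq_true, List.mem_range, Bool.or_eq_true, Bool.not_eq_true',
    ← Bool.not_eq_true, Nat.beq_eq] at hcheck
  have hl0 : l ≠ 0 := fun h0 => h.n_pos.ne' (Nat.eq_zero_of_zero_dvd (h0 ▸ hl))
  have h1 := (hcheck (r % n) (Nat.mod_lt _ h.n_pos)).resolve_left fun e =>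
    hr1 (by rw [Nat.ModEq, e, Nat.mod_eq_of_lt hn])
  have h2 := (h1.resolve_left (not_not_intro h'.pow_modEq)) l
    (Nat.lt_succ_of_le (Nat.le_of_dvd h.n_pos hl))
  exact ((h2.resolve_left hl0).resolve_left
    (not_not_intro (Nat.mod_eq_zero_of_dvd hl))).resolve_left (not_not_intro h'.mul_modEq)

end IsMetacyclicPair

/-- The case `r = 0`, excluded from `IsMetacyclicPair`, forces `n = 1`; the group is then generated
by `b` alone, against noncommutativity. -/
theorem exists_isMetacyclicPair {n t l r : ℕ} (hn : 0 < n) (ht : 0 < t)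
    (h1 : r ^ t ≡ 1 [MOD n]) (h2 : l * r ≡ l [MOD n]) {G : Type*} [Group G]
    (f : G ≃* MetacyclicGroup n t l r) (hab : ¬ ∀ x y : G, x * y = y * x) :
    ∃ a b : G, IsMetacyclicPair n t l r a b := by
  rcases Nat.eq_zero_or_pos r with rfl | hr
  · refine absurd (fun x y => ?_) hab
    rw [zero_pow ht.ne'] at h1
    obtain rfl : n = 1 := Nat.dvd_one.1 ((Nat.modEq_zero_iff_dvd).1 h1.symm)
    have ha : (PresentedGroup.of 0 : MetacyclicGroup 1 t l 0) = 1 := by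
      rw [← pow_one (PresentedGroup.of 0 : MetacyclicGroup 1 t l 0)]
      exact PresentedGroup.one_of_mem (rels := metacyclicRels 1 t l 0) (Or.inl rfl)
    have hg : ∀ g : MetacyclicGroup 1 t l 0,
        g ∈ Subgroup.zpowers (PresentedGroup.of 1 : MetacyclicGroup 1 t l 0) := by
      intro g
      have hg : g ∈ Subgroup.closure
          (Set.range (PresentedGroup.of : Fin 2 → MetacyclicGroup 1 t l 0)) := by
        rw [PresentedGroup.closure_range_of]; trivial
      refine (Subgroup.closure_le _).2 ?_ hg
      rintro _ ⟨k, rfl⟩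
      fin_cases k
      · change PresentedGroup.of 0 ∈ _
        rw [ha]
        exact one_mem _
      · exact Subgroup.mem_zpowers _
    apply f.injective
    obtain ⟨i, hi⟩ := hg (f x)
    obtain ⟨k, hk⟩ := hg (f y)
    rw [map_mul, map_mul, ← hi, ← hk]
    exact (Commute.refl _).zpow_zpow i k
  · exact ⟨_, _, (MetacyclicGroup.isMetacyclicPair hn ht hr h1 h2).map f.symm⟩

theorem mainTheorem11 :
    -- the classification, and which semi-rational groups are uniformly semi-rational
    (∀ n t l r : ℕ, 0 < n → 0 < t → r ^ t ≡ 1 [MOD n] → l * r ≡ l [MOD n] → l ∣ n →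
      ∀ (G : Type*) [Group G], Nonempty (G ≃* MetacyclicGroup n t l r) →
        (¬ ∀ x y : G, x * y = y * x) →
          (IsSemiRationalGroup G ↔
            IsInverseSemiRationalGroup G ∨ IsInUniformList G ∨ IsInExceptionalList G) ∧
          (IsSemiRationalGroup G →
            (IsUniformlySemiRationalGroup G ↔ ¬ IsInExceptionalList G))) ∧
    -- the first sixteen listed groups: the indicated `m`, and none is inverse semi-rational
    (∀ (n t l r : ℕ) (m : ℤ), (n, t, l, r, m) ∈ uniformList →
      IsMSemiRationalGroup m (MetacyclicGroup n t l r) ∧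
      ¬ IsInverseSemiRationalGroup (MetacyclicGroup n t l r)) ∧
    -- the last two listed groups: semi-rational, not uniformly (so not inverse) semi-rational,
    -- and not isomorphic to each other
    (IsSemiRationalGroup (MetacyclicGroup 8 4 4 3) ∧
      ¬ IsUniformlySemiRationalGroup (MetacyclicGroup 8 4 4 3)) ∧
    (IsSemiRationalGroup (MetacyclicGroup 12 4 6 11) ∧
      ¬ IsUniformlySemiRationalGroup (MetacyclicGroup 12 4 6 11)) ∧
    ¬ Nonempty (MetacyclicGroup 8 4 4 3 ≃* MetacyclicGroup 12 4 6 11) := by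
  refine ⟨?_, fun n t l r m he => uniformList_spec he,
    ⟨isSemiRationalGroup_8_4_4_3, not_isUniformlySemiRationalGroup_8_4_4_3⟩,
    ⟨isSemiRationalGroup_12_4_6_11, not_isUniformlySemiRationalGroup_12_4_6_11⟩,
    not_nonempty_mulEquiv_exceptional⟩
  rintro n t l r hn ht h1 h2 hl G _ ⟨f⟩ hab
  obtain ⟨a, b, h⟩ := exists_isMetacyclicPair hn ht h1 h2 f hab
  have hcases := fun hG => h.cases_of_isSemiRationalGroup hl hG hab
  refine ⟨⟨hcases, ?_⟩, fun hG => ⟨fun hu he => he.not_isUniformlySemiRationalGroup hu,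
    fun he => ?_⟩⟩
  · rintro (hi | hu | he)
    · exact (isMSemiRationalGroup_neg_one_iff.2 hi).isSemiRationalGroup
    · obtain ⟨m, hm⟩ := hu.isUniformlySemiRationalGroup
      exact hm.isSemiRationalGroup
    · exact he.isSemiRationalGroup
  · rcases hcases hG with hi | hu | he'
    · exact ⟨-1, isMSemiRationalGroup_neg_one_iff.2 hi⟩
    · exact hu.isUniformlySemiRationalGroup
    · exact absurd he' he
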